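/- Let $X$ be a real Banach space with continuous dual $X^*$ and bidual $X^{**}$; identify $X$ with its canonical image in $X^{**}$ and write $\langle\cdot,\cdot\rangle$ for the duality pairings. Let $A:X\rightrightarrows X^*$ be a set-valued operator with graph $\operatorname{gra}A=\{(x,x^*)\in X\times X^* : x^*\in Ax\}$. Suppose that $A$ is maximally monotone, that is, $\langle x-y,x^*-y^*\rangle\ge 0$ for all $(x,x^*),(y,y^*)\in\operatorname{gra}A$, and $A$ has no proper monotone extension in the sense of graph inclusion. Suppose also that $A$ is of type (NI), that is, $$\inf_{(a,a^*)\in\operatorname{gra}A}\langle a-x^{**},a^*-x^*\rangle\le 0\qquad\text{for all }(x^{**},x^*)\in X^{**}\times X^*.$$ Then $A$ is of type (D): for every $(x^{**},x^*)\in X^{**}\times X^*$ with $$\inf_{(a,a^*)\in\operatorname{gra}A}\langle a-x^{**},a^*-x^*\rangle\ge 0$$ there is a bounded net $(a_\alpha,a^*_\alpha)_{\alpha\in\Gamma}$ in $\operatorname{gra}A$ such that $a_\alpha\to x^{**}$ in the weak$^*$ topology $\omega(X^{**},X^*)$ and $a^*_\alpha\to x^*$ in the norm of $X^*$. -/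

import Mathlib

open Filter Topology

universe u

section MonotoneOperators

variable {X : Type u} [NormedAddCommGroup X] [NormedSpace ℝ X]

/-- The graph of a set-valued operator from `X` to its continuous dual. -/
def SetOp.gra (A : X → Set (StrongDual ℝ X)) : Set (X × StrongDual ℝ X) :=
  {p | p.2 ∈ A p.1}

/-- `A` is monotone: `⟨x - y, x* - y*⟩ ≥ 0` for all `(x, x*)`, `(y, y*)` in its graph. -/
def SetOp.IsMonotone (A : X → Set (StrongDual ℝ X)) : Prop :=
  ∀ p ∈ SetOp.gra A, ∀ q ∈ SetOp.gra A, 0 ≤ (p.2 - q.2) (p.1 - q.1)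

/-- `A` is monotone and has no proper monotone extension, in the sense of graph inclusion. -/
def SetOp.IsMaximallyMonotone (A : X → Set (StrongDual ℝ X)) : Prop :=
  SetOp.IsMonotone A ∧
    ∀ B : X → Set (StrongDual ℝ X), SetOp.IsMonotone B →
      SetOp.gra A ⊆ SetOp.gra B → SetOp.gra B = SetOp.gra A

/-- The infimum over `(a, a*)` in the graph of `A` of `⟨a - x**, a* - x*⟩`, in the extended reals,
where `a` is identified with its canonical image in the bidual. -/
noncomputable def SetOp.relInf (A : X → Set (StrongDual ℝ X))
    (xss : StrongDual ℝ (StrongDual ℝ X)) (xs : StrongDual ℝ X) : EReal :=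
  ⨅ p ∈ SetOp.gra A,
    (((NormedSpace.inclusionInDoubleDual ℝ X p.1 - xss) (p.2 - xs) : ℝ) : EReal)

/-- Type (NI), negative infimum. -/
def SetOp.IsTypeNI (A : X → Set (StrongDual ℝ X)) : Prop :=
  ∀ (xss : StrongDual ℝ (StrongDual ℝ X)) (xs : StrongDual ℝ X), SetOp.relInf A xss xs ≤ 0

/-- Type (D), dense type: each `(x**, x*)` with `inf ⟨a - x**, a* - x*⟩ ≥ 0` over the graph of `A`
is the limit of a bounded net in the graph, for the weak-star topology `ω(X**, X*)` on the bidual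
and the norm topology on the dual. -/
def SetOp.IsTypeD (A : X → Set (StrongDual ℝ X)) : Prop :=
  ∀ (xss : StrongDual ℝ (StrongDual ℝ X)) (xs : StrongDual ℝ X), 0 ≤ SetOp.relInf A xss xs →
    ∃ (Γ : Type u) (_ : Preorder Γ) (_ : IsDirectedOrder Γ) (_ : Nonempty Γ)
      (a : Γ → X) (as : Γ → StrongDual ℝ X),
      (∀ γ, (a γ, as γ) ∈ SetOp.gra A) ∧
      (∃ M : ℝ, ∀ γ, ‖a γ‖ ≤ M ∧ ‖as γ‖ ≤ M) ∧
      Tendsto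
        (fun γ => (StrongDual.toWeakDual (NormedSpace.inclusionInDoubleDual ℝ X (a γ)), as γ))
        atTop
        (𝓝 ((StrongDual.toWeakDual xss, xs) :
          WeakDual ℝ (StrongDual ℝ X) × StrongDual ℝ X))

end MonotoneOperators

/-! Put `G = gra A`. Type (NI) says that the Fenchel conjugate of the pairing restricted to `G`
dominates the pairing on X** × X*. The hypothesis on (x**, x*) says that there the conjugate is at
most the pairing, so the two touch. As the conjugate is convex, the derivative of the pairing is
then a subgradient of it (`ConjugateDominates.tangent_le`).

Hence, by Hahn–Banach and Goldstine, `pairingHull G` has points that approximate (x**, x*), with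
controlled norm and with height barely above ⟨x**, x*⟩
(`ConjugateDominates.exists_mem_pairingHull_approx`). Monotonicity makes them almost monotonically
related to `G`. A Brøndsted–Rockafellar iteration (`ConjugateDominates.exists_mem_near`), which uses
(NI), completeness and maximality, moves them slightly, into `G`. Finite sets of functionals and
tolerances index the net. -/

/-! ### Separation, norm duality and Goldstine. -/

/-- A convex function lying above a convex set turned upside down can be separated from it by a
continuous affine function. -/
lemma exists_affine_between {E : Type*} [NormedAddCommGroup E] [NormedSpace ℝ E]
    {K : Set (E × ℝ)} (hK : Convex ℝ K) (hne : K.Nonempty) {g : E → ℝ}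
    (hg : ConvexOn ℝ Set.univ g) (hgc : Continuous g) {c : ℝ}
    (h : ∀ z ∈ K, c ≤ z.2 + g z.1) :
    ∃ (l : StrongDual ℝ E) (b : ℝ), (∀ z ∈ K, l z.1 - b ≤ z.2) ∧ ∀ w, c + b - l w ≤ g w := by
  have hU : Convex ℝ {p : E × ℝ | p.2 + g p.1 < c} := by
    have h1 : ConvexOn ℝ Set.univ fun p : E × ℝ => p.2 + g p.1 :=
      ((LinearMap.snd ℝ E ℝ).convexOn convex_univ).add
        (hg.comp_linearMap (LinearMap.fst ℝ E ℝ))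
    simpa using h1.convex_lt c
  have hUo : IsOpen {p : E × ℝ | p.2 + g p.1 < c} :=
    isOpen_lt (by fun_prop) continuous_const
  have hd : Disjoint {p : E × ℝ | p.2 + g p.1 < c} K := by
    rw [Set.disjoint_left]
    intro z hz hzK
    exact absurd (h z hzK) (not_le.2 hz)
  obtain ⟨f, v, hf1, hf2⟩ := geometric_hahn_banach_open hU hUo hK hd
  have hf : ∀ (e : E) (s : ℝ), f (e, s) = f (e, 0) + s * f (0, 1) := by
    intro e s
    have : ((e, s) : E × ℝ) = (e, 0) + s • (0, 1) := by simp
    rw [this, map_add, map_smul, smul_eq_mul]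
  obtain ⟨⟨e, r⟩, he⟩ := hne
  have hk : 0 < f (0, 1) := by
    -- A point of the open set directly below a point of `K` shows that the separating functional is
    -- not vertical and fixes its sign.
    have h1 := hf1 (e, min (r - 1) (c - g e - 1)) (by
      have := min_le_right (r - 1) (c - g e - 1)
      simp only [Set.mem_ofPred_eq]; linarith)
    have h2 := hf2 _ he
    rw [hf] at h1 h2
    have h3 := min_le_left (r - 1) (c - g e - 1)
    by_contra! h4
    nlinarith
  refine ⟨-(f (0, 1))⁻¹ • f.comp (ContinuousLinearMap.inl ℝ E ℝ), -(f (0, 1))⁻¹ * v, ?_, ?_⟩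
  · rintro ⟨x, s⟩ hz
    have h2 := hf2 _ hz
    rw [hf] at h2
    have : (f (0, 1))⁻¹ * v ≤ (f (0, 1))⁻¹ * (f (x, 0) + s * f (0, 1)) := by gcongr
    have h5 : (f (0, 1))⁻¹ * (f (x, 0) + s * f (0, 1)) = (f (0, 1))⁻¹ * f (x, 0) + s := by
      field_simp
    simp
    linarith
  · intro w
    have h1 : f (w, 0) + (c - g w) * f (0, 1) ≤ v := by
      refine le_of_forall_pos_lt_add fun ε hε => ?_
      have h1 := hf1 (w, c - g w - ε / f (0, 1)) (by
        have : 0 < ε / f (0, 1) := by positivity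
        simp only [Set.mem_ofPred_eq]; linarith)
      rw [hf, sub_mul, div_mul_cancel₀ _ hk.ne'] at h1
      linarith
    have : (f (0, 1))⁻¹ * (f (w, 0) + (c - g w) * f (0, 1)) ≤ (f (0, 1))⁻¹ * v := by gcongr
    have h5 : (f (0, 1))⁻¹ * (f (w, 0) + (c - g w) * f (0, 1))
      = (f (0, 1))⁻¹ * f (w, 0) + (c - g w) := by field_simp
    simp
    linarith

lemma convexOn_norm_clm_sub {E F : Type*} [NormedAddCommGroup E] [NormedSpace ℝ E]
    [NormedAddCommGroup F] [NormedSpace ℝ F] (L : E →L[ℝ] F) (c : F) :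
    ConvexOn ℝ Set.univ fun x => ‖L x - c‖ := by
  refine ⟨convex_univ, fun x _ y _ a b ha hb hab => ?_⟩
  have : L (a • x + b • y) - c = a • (L x - c) + b • (L y - c) := by
    rw [map_add, map_smul, map_smul]
    nth_rewrite 1 [← one_smul ℝ c]
    rw [← hab]; module
  simp only [this]
  refine (norm_add_le _ _).trans ?_
  rw [norm_smul, norm_smul, Real.norm_of_nonneg ha, Real.norm_of_nonneg hb]
  rfl

/-- The conjugate of half the squared norm is half the squared dual norm; a vector that almost norms
`f`, scaled by `‖f‖` and signed, nearly attains it. -/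
lemma exists_half_sq_add_apply_le {E : Type*} [NormedAddCommGroup E] [NormedSpace ℝ E]
    (f : StrongDual ℝ E) {δ : ℝ} (hδ : 0 < δ) :
    ∃ z : E, ‖z‖ ^ 2 / 2 + f z ≤ -(‖f‖ ^ 2 / 2) + δ := by
  obtain ⟨x, hx, hfx⟩ := f.exists_lt_apply_of_lt_opNorm
    (r := ‖f‖ - δ / (‖f‖ + 1)) (by have : 0 < δ / (‖f‖ + 1) := by positivity
                                   linarith)
  have h1 : ‖f‖ * (δ / (‖f‖ + 1)) ≤ δ := by
    rw [mul_div_assoc', div_le_iff₀ (by positivity)]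
    nlinarith [norm_nonneg f]
  have h2 : ‖f‖ * (‖f‖ - δ / (‖f‖ + 1)) ≤ ‖f‖ * ‖f x‖ := by gcongr
  have h3 : (‖f‖ * ‖x‖) ^ 2 ≤ ‖f‖ ^ 2 := by
    have : ‖f‖ * ‖x‖ ≤ ‖f‖ := mul_le_of_le_one_right (norm_nonneg _) hx.le
    gcongr
  rcases le_total 0 (f x) with h | h
  · refine ⟨-(‖f‖ • x), ?_⟩
    rw [Real.norm_of_nonneg h] at h2
    simp only [norm_neg, norm_smul, norm_norm, map_neg, map_smul, smul_eq_mul]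
    nlinarith
  · refine ⟨‖f‖ • x, ?_⟩
    rw [Real.norm_of_nonpos h] at h2
    simp only [norm_smul, norm_norm, map_smul, smul_eq_mul]
    nlinarith

/-- Goldstine: a point of the bidual is approximated on finitely many functionals by points of the
space of no larger norm. -/
lemma exists_norm_le_forall_abs_sub_lt {X : Type*} [NormedAddCommGroup X] [NormedSpace ℝ X]
    (φ : StrongDual ℝ (StrongDual ℝ X)) (F : Finset (StrongDual ℝ X)) {δ : ℝ} (hδ : 0 < δ) :
    ∃ v : X, ‖v‖ ≤ ‖φ‖ ∧ ∀ f ∈ F, |f v - φ f| < δ := by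
  classical
  let T : X →L[ℝ] (F → ℝ) := ContinuousLinearMap.pi fun f => (f : StrongDual ℝ X)
  have hmem : (fun f : F => φ f) ∈ closure (T '' Metric.closedBall 0 ‖φ‖) := by
    by_contra hn
    obtain ⟨l, s, h1, h2⟩ := geometric_hahn_banach_closed_point
      (((convex_closedBall (0 : X) ‖φ‖).linear_image T.toLinearMap).closure) isClosed_closure hn
    have hl : ∀ c : F → ℝ, l c = ∑ f, c f * l (Pi.single f 1) := by
      intro c
      conv_lhs => rw [← Finset.univ_sum_single c, map_sum]
      refine Finset.sum_congr rfl fun f _ => ?_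
      rw [← smul_eq_mul, ← map_smul, ← Pi.single_smul, smul_eq_mul, mul_one]
    let p : StrongDual ℝ X := ∑ f : F, l (Pi.single f 1) • (f : StrongDual ℝ X)
    have hp : ∀ x, l (T x) = p x := by
      intro x
      rw [hl]
      simp [p, T, mul_comm]
    have hφ : l (fun f : F => φ f) = φ p := by
      rw [hl]
      simp [p, mul_comm]
    have h3 : ∀ x : X, ‖x‖ ≤ ‖φ‖ → p x < s := fun x hx => by
      rw [← hp]
      exact h1 _ (subset_closure ⟨x, by simpa using hx, rfl⟩)
    rw [hφ] at h2
    have hs : 0 < s := by simpa using h3 0 (by rw [norm_zero]; exact norm_nonneg φ)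
    have h4 : φ p ≤ ‖φ‖ * ‖p‖ := (le_abs_self _).trans (φ.le_opNorm p)
    have hφ0 : 0 < ‖φ‖ := by
      by_contra! h
      nlinarith [norm_nonneg p]
    have h5 : ‖p‖ ≤ s / ‖φ‖ := by
      refine ContinuousLinearMap.opNorm_le_of_unit_norm (by positivity) fun x hx => ?_
      rw [le_div_iff₀ hφ0, Real.norm_eq_abs]
      have hn : ‖‖φ‖ • x‖ ≤ ‖φ‖ := by
        rw [norm_smul, hx, mul_one, Real.norm_of_nonneg hφ0.le]
      have ha := h3 (‖φ‖ • x) hn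
      have hb := h3 (-(‖φ‖ • x)) (by rwa [norm_neg])
      simp only [map_neg, map_smul, smul_eq_mul] at ha hb
      rcases abs_cases (p x) with ⟨h, _⟩ | ⟨h, _⟩ <;> rw [h] <;> linarith
    rw [le_div_iff₀ hφ0] at h5
    linarith
  obtain ⟨_, ⟨v, hv, rfl⟩, hvd⟩ := Metric.mem_closure_iff.1 hmem δ hδ
  refine ⟨v, by simpa using hv, fun f hf => ?_⟩
  have := (dist_le_pi_dist _ _ (⟨f, hf⟩ : F)).trans_lt hvd
  rw [dist_comm, Real.dist_eq] at this
  simpa [T] using this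

/-! ### Convex hull of the pairing and the Brøndsted–Rockafellar property. -/

section

variable {X : Type u} [NormedAddCommGroup X] [NormedSpace ℝ X]

/-- The convex hull of the graph of the duality pairing over `G`. -/
def pairingHull (G : Set (X × StrongDual ℝ X)) : Set ((X × StrongDual ℝ X) × ℝ) :=
  convexHull ℝ ((fun p => (p, p.2 p.1)) '' G)

lemma le_of_mem_pairingHull {G : Set (X × StrongDual ℝ X)} {l : StrongDual ℝ (X × StrongDual ℝ X)}
    {b : ℝ} (h : ∀ p ∈ G, l p - b ≤ p.2 p.1) {z : (X × StrongDual ℝ X) × ℝ}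
    (hz : z ∈ pairingHull G) : l z.1 - b ≤ z.2 := by
  have hc : Convex ℝ {z : (X × StrongDual ℝ X) × ℝ | l z.1 - b ≤ z.2} := by
    rintro ⟨x, r⟩ hx ⟨y, s⟩ hy a c ha hc hac
    have hx' : l x - b ≤ r := hx
    have hy' : l y - b ≤ s := hy
    change l (a • x + c • y) - b ≤ a * r + c * s
    rw [map_add, map_smul, map_smul, smul_eq_mul, smul_eq_mul]
    obtain rfl : c = 1 - a := by linarith
    nlinarith [mul_le_mul_of_nonneg_left hx' ha, mul_le_mul_of_nonneg_left hy' hc]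
  refine convexHull_min ?_ hc hz
  rintro _ ⟨p, hp, rfl⟩
  exact h p hp

/-- The affine bound defined by a pair in `X** × X*` extends from `G` to the hull. -/
lemma pairing_le_of_mem_pairingHull {G : Set (X × StrongDual ℝ X)}
    {φ : StrongDual ℝ (StrongDual ℝ X)} {f : StrongDual ℝ X} {b : ℝ}
    (h : ∀ p ∈ G, f p.1 + φ p.2 - b ≤ p.2 p.1) {z : (X × StrongDual ℝ X) × ℝ}
    (hz : z ∈ pairingHull G) : f z.1.1 + φ z.1.2 - b ≤ z.2 := by
  have := le_of_mem_pairingHull (G := G) (l := f.coprod φ) (b := b) (by simpa using h) hz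
  simpa using this

/-- The set form of type (NI): the conjugate of the pairing on `G` dominates the pairing
on `X** × X*`. -/
def ConjugateDominates (G : Set (X × StrongDual ℝ X)) : Prop :=
  ∀ (φ : StrongDual ℝ (StrongDual ℝ X)) (f : StrongDual ℝ X) (b : ℝ),
    (∀ p ∈ G, f p.1 + φ p.2 - b ≤ p.2 p.1) → φ f ≤ b

lemma ConjugateDominates.nonempty {G : Set (X × StrongDual ℝ X)} (hG : ConjugateDominates G) :
    G.Nonempty := by
  by_contra hn
  rw [Set.not_nonempty_iff_eq_empty] at hn
  have := hG 0 0 (-1) (by simp [hn])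
  simp at this
  linarith

/-- Fenchel duality in the form used below: `b` bounds the conjugate at `(φ, f)`, so (NI) adds `φ f
≤ b`. -/
lemma ConjugateDominates.exists_affine {G : Set (X × StrongDual ℝ X)} (hG : ConjugateDominates G)
    {g : X × StrongDual ℝ X → ℝ} (hg : ConvexOn ℝ Set.univ g) (hgc : Continuous g) {c : ℝ}
    (h : ∀ z ∈ pairingHull G, c ≤ z.2 + g z.1) :
    ∃ (φ : StrongDual ℝ (StrongDual ℝ X)) (f : StrongDual ℝ X) (b : ℝ),
      (∀ p ∈ G, f p.1 + φ p.2 - b ≤ p.2 p.1) ∧ φ f ≤ b ∧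
      ∀ x y, c + b - (f x + φ y) ≤ g (x, y) := by
  obtain ⟨l, b, h1, h2⟩ := exists_affine_between (convex_convexHull ℝ _)
    ((hG.nonempty.image _).convexHull) hg hgc h
  have hl : ∀ x y, l (x, y) = l.comp (ContinuousLinearMap.inl ℝ _ _) x
      + l.comp (ContinuousLinearMap.inr ℝ _ _) y := by
    intro x y
    simp [← map_add]
  have h3 : ∀ p ∈ G, l.comp (ContinuousLinearMap.inl ℝ _ _) p.1
      + l.comp (ContinuousLinearMap.inr ℝ _ _) p.2 - b ≤ p.2 p.1 := by
    intro p hp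
    rw [← hl]
    exact h1 _ (subset_convexHull ℝ _ ⟨p, hp, rfl⟩)
  refine ⟨_, _, b, h3, hG _ _ _ h3, fun x y => ?_⟩
  rw [← hl]
  exact h2 _

/-- If this failed, separation followed by minimising both half squares would give `(φ - j) (f -
y.2)` below minus half the sum of the squared norms, where `j` is the image of `y.1` in the bidual.
-/
lemma ConjugateDominates.exists_mem_pairingHull_near {G : Set (X × StrongDual ℝ X)}
    (hG : ConjugateDominates G) (y : X × StrongDual ℝ X) {η : ℝ} (hη : 0 < η) :
    ∃ z ∈ pairingHull G, z.2 - z.1.2 z.1.1 + (z.1.2 - y.2) (z.1.1 - y.1)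
      + (‖z.1.1 - y.1‖ ^ 2 / 2 + ‖z.1.2 - y.2‖ ^ 2 / 2) < η := by
  by_contra! hn
  let g : X × StrongDual ℝ X → ℝ := fun w =>
    (1 / 2 : ℝ) * ‖w.1 - y.1‖ ^ 2 + (1 / 2 : ℝ) * ‖w.2 - y.2‖ ^ 2
      + (y.2 y.1 - (y.2 w.1 + w.2 y.1))
  have hg : ConvexOn ℝ Set.univ g := by
    have h1 : ConvexOn ℝ Set.univ fun w : X × StrongDual ℝ X => ‖w.1 - y.1‖ ^ 2 :=
      (convexOn_norm_clm_sub (ContinuousLinearMap.fst ℝ X (StrongDual ℝ X)) y.1).pow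
        (fun _ _ => norm_nonneg _) 2
    have h2 : ConvexOn ℝ Set.univ fun w : X × StrongDual ℝ X => ‖w.2 - y.2‖ ^ 2 :=
      (convexOn_norm_clm_sub (ContinuousLinearMap.snd ℝ X (StrongDual ℝ X)) y.2).pow
        (fun _ _ => norm_nonneg _) 2
    have h3 : ConvexOn ℝ Set.univ
        fun w : X × StrongDual ℝ X => y.2 y.1 - (y.2 w.1 + w.2 y.1) := by
      refine ⟨convex_univ, fun p _ q _ a c _ _ hac => le_of_eq ?_⟩
      obtain rfl : c = 1 - a := by linarith
      simp
      ring
    exact ((h1.smul (by norm_num : (0 : ℝ) ≤ 1 / 2)).add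
      (h2.smul (by norm_num : (0 : ℝ) ≤ 1 / 2))).add h3
  have hgc : Continuous g := by fun_prop
  obtain ⟨φ, f, b, -, hb, h⟩ := hG.exists_affine hg hgc (c := η) (by
    intro z hz
    have := hn z hz
    simp only [sub_apply, map_sub] at this
    simp only [g]
    linarith)
  let j := NormedSpace.inclusionInDoubleDual ℝ X y.1
  obtain ⟨u, hu⟩ := exists_half_sq_add_apply_le (f - y.2) (show 0 < η / 4 by positivity)
  obtain ⟨v, hv⟩ := exists_half_sq_add_apply_le (φ - j) (show 0 < η / 4 by positivity)
  have h1 := h (y.1 + u) (y.2 + v)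
  have h2 : |(φ - j) (f - y.2)| ≤ ‖φ - j‖ * ‖f - y.2‖ := (φ - j).le_opNorm _
  have h3 := neg_abs_le ((φ - j) (f - y.2))
  have hj : ∀ k, j k = k y.1 := fun k => rfl
  simp only [g, add_sub_cancel_left, map_add, add_apply] at h1
  simp only [sub_apply, map_sub, hj] at hu hv h2 h3
  nlinarith [sq_nonneg (‖φ - j‖ - ‖f - y.2‖)]

/-- A Brøndsted–Rockafellar property. -/
lemma ConjugateDominates.exists_mem_near [CompleteSpace X] {G : Set (X × StrongDual ℝ X)}
    (hG : ConjugateDominates G)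
    (hmono : ∀ p ∈ G, ∀ q ∈ G, 0 ≤ (p.2 - q.2) (p.1 - q.1))
    (hmax : ∀ y : X × StrongDual ℝ X, (∀ q ∈ G, 0 ≤ (q.2 - y.2) (q.1 - y.1)) → y ∈ G)
    {ε : ℝ} (hε : 0 < ε) {y : X × StrongDual ℝ X}
    (hy : ∀ q ∈ G, -ε ^ 2 ≤ (q.2 - y.2) (q.1 - y.1)) :
    ∃ p ∈ G, dist y p ≤ 4 * ε := by
  -- The monotonicity defect is quartered at each step, so the step lengths halve and sum to at most
  -- `4 * ε`.
  let P : ℕ → X × StrongDual ℝ X → Prop := fun n w =>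
    ∀ q ∈ G, -(ε / 2 ^ n) ^ 2 ≤ (q.2 - w.2) (q.1 - w.1)
  have hstep : ∀ n w, P n w → ∃ w', P (n + 1) w' ∧ dist w w' ≤ 4 * ε / 2 / 2 ^ n := by
    intro n w hw
    have hη : 0 < (ε / 2 ^ (n + 1)) ^ 2 := by positivity
    obtain ⟨z, hz, hlt⟩ := hG.exists_mem_pairingHull_near w hη
    have hw' := pairing_le_of_mem_pairingHull (f := w.2)
      (φ := NormedSpace.inclusionInDoubleDual ℝ X w.1) (b := w.2 w.1 + (ε / 2 ^ n) ^ 2)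
      (fun q hq => by
        have := hw q hq
        simp only [sub_apply, map_sub] at this
        simp only [NormedSpace.dual_def]
        linarith) hz
    simp only [NormedSpace.dual_def] at hw'
    -- Hence `z.2` exceeds the pairing at `z.1` by less than `(ε / 2 ^ (n + 1)) ^ 2`, which bounds
    -- the next defect.
    have hnn : -(‖z.1.1 - w.1‖ ^ 2 / 2 + ‖z.1.2 - w.2‖ ^ 2 / 2)
        ≤ (z.1.2 - w.2) (z.1.1 - w.1) := by
      have h2 : |(z.1.2 - w.2) (z.1.1 - w.1)| ≤ ‖z.1.2 - w.2‖ * ‖z.1.1 - w.1‖ :=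
        (z.1.2 - w.2).le_opNorm _
      have h3 := neg_abs_le ((z.1.2 - w.2) (z.1.1 - w.1))
      nlinarith [sq_nonneg (‖z.1.1 - w.1‖ - ‖z.1.2 - w.2‖)]
    refine ⟨z.1, fun q hq => ?_, ?_⟩
    · have hq' := pairing_le_of_mem_pairingHull (f := q.2)
        (φ := NormedSpace.inclusionInDoubleDual ℝ X q.1) (b := q.2 q.1)
        (fun p hp => by
          have := hmono p hp q hq
          simp only [sub_apply, map_sub] at this
          simp only [NormedSpace.dual_def]
          linarith) hz
      simp only [NormedSpace.dual_def] at hq'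
      have h4 : (q.2 - z.1.2) (q.1 - z.1.1)
          = q.2 q.1 - q.2 z.1.1 - z.1.2 q.1 + z.1.2 z.1.1 := by
        simp only [sub_apply, map_sub]; ring
      rw [h4]
      linarith
    -- The half squares sum to less than the new defect plus the old one, hence to less than twice
    -- the old.
    · have h5 : (ε / 2 ^ (n + 1)) ^ 2 ≤ (ε / 2 ^ n) ^ 2 := by
        have : ε / 2 ^ (n + 1) ≤ ε / 2 ^ n := by
          gcongr
          · norm_num
          · omega
        gcongr
      have h6 : (z.1.2 - w.2) (z.1.1 - w.1)
          = z.1.2 z.1.1 - z.1.2 w.1 - w.2 z.1.1 + w.2 w.1 := by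
        simp only [sub_apply, map_sub]; ring
      have h7 : 4 * ε / 2 / 2 ^ n = 2 * (ε / 2 ^ n) := by ring
      have h8 : 0 < ε / 2 ^ n := by positivity
      rw [h7, dist_comm, Prod.dist_eq, dist_eq_norm, dist_eq_norm]
      refine max_le ?_ ?_
      · refine abs_le_of_sq_le_sq' ?_ (by positivity) |>.2
        nlinarith [sq_nonneg ‖z.1.2 - w.2‖]
      · refine abs_le_of_sq_le_sq' ?_ (by positivity) |>.2
        nlinarith [sq_nonneg ‖z.1.1 - w.1‖]
  choose! s hs1 hs2 using hstep
  let u : ℕ → X × StrongDual ℝ X := fun n => Nat.rec y (fun n w => s n w) n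
  have hu : ∀ n, P n (u n) := by
    intro n
    induction n with
    | zero => simpa [P, u] using hy
    | succ n ih => exact hs1 n _ ih
  have hd : ∀ n, dist (u n) (u (n + 1)) ≤ 4 * ε / 2 / 2 ^ n := fun n => hs2 n _ (hu n)
  obtain ⟨p, hp⟩ := cauchySeq_tendsto_of_complete (cauchySeq_of_le_geometric_two hd)
  refine ⟨p, hmax p fun q hq => ?_, dist_le_of_le_geometric_two_of_tendsto₀ hd hp⟩
  have hε0 : Tendsto (fun n : ℕ => -(ε / 2 ^ n) ^ 2) atTop (𝓝 0) := by
    have h1 : Tendsto (fun n : ℕ => ε / (2 : ℝ) ^ n) atTop (𝓝 0) :=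
      tendsto_const_nhds.div_atTop (tendsto_pow_atTop_atTop_of_one_lt one_lt_two)
    simpa using (h1.pow 2).neg
  have hc : Continuous fun w : X × StrongDual ℝ X => (q.2 - w.2) (q.1 - w.1) := by fun_prop
  exact le_of_tendsto_of_tendsto' hε0 ((hc.tendsto p).comp hp) fun n => hu n q hq

end

/-! ### Approximation of touching points. -/

section

variable {X : Type u} [NormedAddCommGroup X] [NormedSpace ℝ X]

/-- At a point where the conjugate of the pairing on `G` touches the pairing, the derivative of
the pairing is a subgradient of the conjugate. -/
lemma ConjugateDominates.tangent_le {G : Set (X × StrongDual ℝ X)} (hG : ConjugateDominates G)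
    {φ₀ : StrongDual ℝ (StrongDual ℝ X)} {f₀ : StrongDual ℝ X}
    (h₀ : ∀ p ∈ G, f₀ p.1 + φ₀ p.2 - φ₀ f₀ ≤ p.2 p.1)
    {φ : StrongDual ℝ (StrongDual ℝ X)} {f : StrongDual ℝ X} {b : ℝ}
    (h : ∀ p ∈ G, f p.1 + φ p.2 - b ≤ p.2 p.1) :
    φ₀ f + φ f₀ - φ₀ f₀ ≤ b := by
  -- Compare conjugate and pairing on the segment to `(φ, f)`, divide by `t`, then let `t` tend to
  -- 0.
  have key : ∀ t : ℝ, 0 < t → t ≤ 1 →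
      (1 - t) * (φ₀ f + φ f₀ - φ₀ f₀) + t * φ f ≤ b := by
    intro t ht ht1
    have h1 := hG ((1 - t) • φ₀ + t • φ) ((1 - t) • f₀ + t • f) ((1 - t) * φ₀ f₀ + t * b)
      (fun p hp => by
        have ha := mul_le_mul_of_nonneg_left (h₀ p hp) (sub_nonneg.2 ht1)
        have hb := mul_le_mul_of_nonneg_left (h p hp) ht.le
        simp only [add_apply, smul_apply, smul_eq_mul]
        linarith)
    simp only [add_apply, smul_apply, smul_eq_mul, map_add, map_smul] at h1
    refine le_of_mul_le_mul_left ?_ ht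
    linarith
  have hc : Continuous fun t : ℝ => (1 - t) * (φ₀ f + φ f₀ - φ₀ f₀) + t * φ f := by fun_prop
  have ht : Tendsto (fun t : ℝ => (1 - t) * (φ₀ f + φ f₀ - φ₀ f₀) + t * φ f) (𝓝[>] 0)
      (𝓝 (φ₀ f + φ f₀ - φ₀ f₀)) := by
    have := hc.tendsto 0
    simp only [sub_zero, one_mul, zero_mul, add_zero] at this
    exact this.mono_left nhdsWithin_le_nhds
  refine le_of_tendsto ht ?_
  filter_upwards [Ioc_mem_nhdsGT (zero_lt_one' ℝ)] with t ht
  exact key t ht.1 ht.2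

/-- Otherwise an affine function separates the hull from the penalty. Testing it at `(v, f₀)`, with
`v` a Goldstine approximant of `φ₀`, makes the penalty negligible and contradicts the subgradient
inequality. -/
lemma ConjugateDominates.exists_mem_pairingHull_penalty {G : Set (X × StrongDual ℝ X)}
    (hG : ConjugateDominates G) {φ₀ : StrongDual ℝ (StrongDual ℝ X)} {f₀ : StrongDual ℝ X}
    (h₀ : ∀ p ∈ G, f₀ p.1 + φ₀ p.2 - φ₀ f₀ ≤ p.2 p.1)
    (F : Finset (StrongDual ℝ X)) {N η : ℝ} (hN : 0 ≤ N) (hη : 0 < η) :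
    ∃ z ∈ pairingHull G, z.2 + N * (∑ f ∈ F, |f z.1.1 - φ₀ f| + ‖z.1.2 - f₀‖
      + max (‖z.1.1‖ - ‖φ₀‖) 0) < φ₀ f₀ + η := by
  by_contra! hn
  let g : X × StrongDual ℝ X → ℝ := fun w =>
    N * (∑ f ∈ F, |f w.1 - φ₀ f| + ‖w.2 - f₀‖ + max (‖w.1‖ - ‖φ₀‖) 0)
  have hg : ConvexOn ℝ Set.univ g := by
    have h1 : ConvexOn ℝ Set.univ
        fun w : X × StrongDual ℝ X => ∑ f ∈ F, |f w.1 - φ₀ f| := by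
      classical
      induction F using Finset.induction_on with
      | empty => simpa using convexOn_const (0 : ℝ) convex_univ
      | insert f F hf ih =>
        simp only [Finset.sum_insert hf]
        refine (convexOn_norm_clm_sub
          (f.comp (ContinuousLinearMap.fst ℝ X (StrongDual ℝ X))) (φ₀ f)).add ?_
        refine ⟨convex_univ, fun p _ q _ a c ha hc hac => ?_⟩
        simp only [smul_eq_mul, Finset.mul_sum, ← Finset.sum_add_distrib]
        exact Finset.sum_le_sum fun k _ => (convexOn_norm_clm_sub
          (k.comp (ContinuousLinearMap.fst ℝ X (StrongDual ℝ X))) (φ₀ k)).2 trivial trivial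
            ha hc hac
    have h2 : ConvexOn ℝ Set.univ fun w : X × StrongDual ℝ X => ‖w.2 - f₀‖ :=
      convexOn_norm_clm_sub (ContinuousLinearMap.snd ℝ X (StrongDual ℝ X)) f₀
    have h3 : ConvexOn ℝ Set.univ fun w : X × StrongDual ℝ X => ‖w.1‖ - ‖φ₀‖ := by
      refine ((convexOn_norm_clm_sub (ContinuousLinearMap.fst ℝ X (StrongDual ℝ X)) 0).add_const
        (-‖φ₀‖)).congr fun w _ => ?_
      simp [sub_eq_add_neg]
    exact ((h1.add h2).add (h3.sup (convexOn_const 0 convex_univ))).smul hN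
  have hgc : Continuous g := by fun_prop
  obtain ⟨φ, f, b, hb, -, h⟩ := hG.exists_affine hg hgc (c := φ₀ f₀ + η) hn
  have hb' := hG.tangent_le h₀ hb
  classical
  -- The error at `f` and the weighted errors over `F` together cost at most `η / 2`.
  let δ : ℝ := η / 2 / (1 + N * F.card)
  have hδ : 0 < δ := by positivity
  obtain ⟨v, hv, hvF⟩ := exists_norm_le_forall_abs_sub_lt φ₀ (insert f F) hδ
  have h1 := h v f₀
  have h2 : max (‖v‖ - ‖φ₀‖) 0 = 0 := max_eq_right (sub_nonpos.2 hv)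
  have h3 : ∑ k ∈ F, |k v - φ₀ k| ≤ F.card * δ := by
    rw [← nsmul_eq_mul]
    exact Finset.sum_le_card_nsmul _ _ _ fun k hk => (hvF k (Finset.mem_insert_of_mem hk)).le
  have h4 := (abs_lt.1 (hvF f (Finset.mem_insert_self _ _))).2
  have h5 : N * ∑ k ∈ F, |k v - φ₀ k| ≤ N * (F.card * δ) := by gcongr
  have h6 : δ * (1 + N * F.card) = η / 2 := div_mul_cancel₀ _ (by positivity)
  simp only [g, h2, sub_self, norm_zero, add_zero] at h1
  nlinarith

/-- Points of the hull bounded independently of `F` that approximate a touching point. -/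
lemma ConjugateDominates.exists_mem_pairingHull_approx {G : Set (X × StrongDual ℝ X)}
    (hG : ConjugateDominates G) {φ₀ : StrongDual ℝ (StrongDual ℝ X)} {f₀ : StrongDual ℝ X}
    (hmono : ∀ p ∈ G, ∀ q ∈ G, 0 ≤ (p.2 - q.2) (p.1 - q.1))
    (h₀ : ∀ p ∈ G, f₀ p.1 + φ₀ p.2 - φ₀ f₀ ≤ p.2 p.1)
    (F : Finset (StrongDual ℝ X)) {η : ℝ} (hη : 0 < η) :
    ∃ z ∈ pairingHull G, (∀ f ∈ F, |f z.1.1 - φ₀ f| ≤ η) ∧ ‖z.1.2 - f₀‖ ≤ η ∧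
      ‖z.1.1‖ ≤ ‖φ₀‖ + η ∧ z.2 < φ₀ f₀ + η := by
  obtain ⟨p, hp⟩ := hG.nonempty
  -- `D` collects the terms independent of `z`. In the weight below, `‖p.1‖ + ‖p.2‖` absorbs the
  -- growth of the lower bound given by `p`, and `D / η` forces the penalty below `η`.
  set D : ℝ := ‖p.2‖ * ‖φ₀‖ + ‖f₀‖ * ‖p.1‖ + |p.2 p.1| + |φ₀ f₀| + η with hD
  have hD0 : 0 < D := by positivity
  obtain ⟨z, hz, hlt⟩ := hG.exists_mem_pairingHull_penalty h₀ F
    (N := ‖p.1‖ + ‖p.2‖ + D / η) (by positivity) hη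
  have hS : 0 ≤ ∑ f ∈ F, |f z.1.1 - φ₀ f| := Finset.sum_nonneg fun _ _ => abs_nonneg _
  have hS1 : ∀ f ∈ F, |f z.1.1 - φ₀ f| ≤ ∑ f ∈ F, |f z.1.1 - φ₀ f| := fun f hf =>
    Finset.single_le_sum (f := fun f => |f z.1.1 - φ₀ f|) (fun _ _ => abs_nonneg _) hf
  set S := ∑ f ∈ F, |f z.1.1 - φ₀ f|
  set s := ‖z.1.2 - f₀‖ with hs
  set t := max (‖z.1.1‖ - ‖φ₀‖) 0
  have hs0 : 0 ≤ s := norm_nonneg _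
  have ht0 : 0 ≤ t := le_max_right _ _
  have ht1 : ‖z.1.1‖ ≤ ‖φ₀‖ + t := by linarith [le_max_left (‖z.1.1‖ - ‖φ₀‖) 0]
  have hlow := pairing_le_of_mem_pairingHull (f := p.2)
        (φ := NormedSpace.inclusionInDoubleDual ℝ X p.1) (b := p.2 p.1)
        (fun q hq => by
          have := hmono q hq p hp
          simp only [sub_apply, map_sub] at this
          simp only [NormedSpace.dual_def]
          linarith) hz
  simp only [NormedSpace.dual_def] at hlow
  have h1 : -(‖p.2‖ * (‖φ₀‖ + t)) ≤ p.2 z.1.1 := by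
    have h2 : |p.2 z.1.1| ≤ ‖p.2‖ * ‖z.1.1‖ := p.2.le_opNorm _
    have h3 : ‖p.2‖ * ‖z.1.1‖ ≤ ‖p.2‖ * (‖φ₀‖ + t) := by gcongr
    linarith [neg_abs_le (p.2 z.1.1)]
  have h2 : -((‖f₀‖ + s) * ‖p.1‖) ≤ z.1.2 p.1 := by
    have h2 : |z.1.2 p.1| ≤ ‖z.1.2‖ * ‖p.1‖ := z.1.2.le_opNorm _
    have h4 : ‖z.1.2‖ ≤ ‖f₀‖ + s := by
      linarith [norm_le_norm_add_norm_sub f₀ z.1.2, norm_sub_rev f₀ z.1.2]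
    have h3 : ‖z.1.2‖ * ‖p.1‖ ≤ (‖f₀‖ + s) * ‖p.1‖ := by gcongr
    linarith [neg_abs_le (z.1.2 p.1)]
  have h3 : D / η * (S + s + t) ≤ D := by
    have e1 : 0 ≤ ‖p.1‖ * S := by positivity
    have e2 : 0 ≤ ‖p.1‖ * t := by positivity
    have e3 : 0 ≤ ‖p.2‖ * S := by positivity
    have e4 : 0 ≤ ‖p.2‖ * s := by positivity
    linarith [le_abs_self (p.2 p.1), le_abs_self (φ₀ f₀)]
  have h4 : S + s + t ≤ η := by
    rw [div_mul_eq_mul_div, div_le_iff₀ hη] at h3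
    exact le_of_mul_le_mul_left h3 hD0
  refine ⟨z, hz, fun f hf => (hS1 f hf).trans (by linarith), by linarith, by linarith, ?_⟩
  have : 0 ≤ (‖p.1‖ + ‖p.2‖ + D / η) * (S + s + t) := by positivity
  linarith

/-- Points of `G` bounded independently of `F` that approximate a touching point. -/
lemma ConjugateDominates.exists_mem_approx [CompleteSpace X] {G : Set (X × StrongDual ℝ X)}
    (hG : ConjugateDominates G) {φ₀ : StrongDual ℝ (StrongDual ℝ X)} {f₀ : StrongDual ℝ X}
    (hmono : ∀ p ∈ G, ∀ q ∈ G, 0 ≤ (p.2 - q.2) (p.1 - q.1))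
    (hmax : ∀ y : X × StrongDual ℝ X, (∀ q ∈ G, 0 ≤ (q.2 - y.2) (q.1 - y.1)) → y ∈ G)
    (h₀ : ∀ p ∈ G, f₀ p.1 + φ₀ p.2 - φ₀ f₀ ≤ p.2 p.1)
    (F : Finset (StrongDual ℝ X)) {ε : ℝ} (hε : 0 < ε) :
    ∃ p ∈ G, (∀ f ∈ F, |f p.1 - φ₀ f| ≤ ε * (1 + ‖f‖)) ∧ ‖p.2 - f₀‖ ≤ ε ∧
      ‖p.1‖ ≤ ‖φ₀‖ + ε := by
  classical
  -- Two errors `η`, from the height and from testing at `f₀` (hence inserted in `F`), and `η *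
  -- (‖φ₀‖ + ε / 2)` from `z.1.2 - f₀` must fit in the defect `(ε / 8) ^ 2`; the displacement is
  -- then at most `ε / 2`.
  obtain ⟨η, hη, hη1, hη2⟩ : ∃ η > 0, η ≤ ε / 2 ∧
      η * (2 + (‖φ₀‖ + ε / 2)) ≤ (ε / 8) ^ 2 := by
    refine ⟨min (ε / 2) ((ε / 8) ^ 2 / (2 + (‖φ₀‖ + ε / 2))), by positivity,
      min_le_left _ _, ?_⟩
    rw [← le_div_iff₀ (by positivity)]
    exact min_le_right _ _
  obtain ⟨z, hz, hzF, hz2, hz1, hzr⟩ :=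
    hG.exists_mem_pairingHull_approx hmono h₀ (insert f₀ F) hη
  obtain ⟨p, hp, hd⟩ := hG.exists_mem_near hmono hmax (show 0 < ε / 8 by positivity) (y := z.1)
    (fun q hq => by
      have hq' := pairing_le_of_mem_pairingHull (f := q.2)
        (φ := NormedSpace.inclusionInDoubleDual ℝ X q.1) (b := q.2 q.1)
        (fun p hp => by
          have := hmono p hp q hq
          simp only [sub_apply, map_sub] at this
          simp only [NormedSpace.dual_def]
          linarith) hz
      simp only [NormedSpace.dual_def] at hq'
      have e1 := (abs_le.1 (hzF f₀ (Finset.mem_insert_self _ _))).1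
      have e2 : |(z.1.2 - f₀) z.1.1| ≤ ‖z.1.2 - f₀‖ * ‖z.1.1‖ := (z.1.2 - f₀).le_opNorm _
      have e3 : ‖z.1.2 - f₀‖ * ‖z.1.1‖ ≤ η * (‖φ₀‖ + ε / 2) := by
        gcongr
        linarith
      have e4 := neg_abs_le ((z.1.2 - f₀) z.1.1)
      have e5 : (q.2 - z.1.2) (q.1 - z.1.1)
          = q.2 q.1 - q.2 z.1.1 - z.1.2 q.1 + z.1.2 z.1.1 := by
        simp only [sub_apply, map_sub]; ring
      have e6 : (z.1.2 - f₀) z.1.1 = z.1.2 z.1.1 - f₀ z.1.1 := rfl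
      rw [e5]
      linarith)
  rw [Prod.dist_eq, dist_eq_norm, dist_eq_norm] at hd
  have hd1 : ‖p.1 - z.1.1‖ ≤ ε / 2 := by
    rw [norm_sub_rev]; linarith [(le_max_left _ _).trans hd]
  have hd2 : ‖p.2 - z.1.2‖ ≤ ε / 2 := by
    rw [norm_sub_rev]; linarith [(le_max_right _ _).trans hd]
  refine ⟨p, hp, fun f hf => ?_, ?_, ?_⟩
  · have e1 := hzF f (Finset.mem_insert_of_mem hf)
    have e2 : |f (p.1 - z.1.1)| ≤ ‖f‖ * ‖p.1 - z.1.1‖ := f.le_opNorm _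
    have e3 : ‖f‖ * ‖p.1 - z.1.1‖ ≤ ‖f‖ * ε := by
      gcongr
      linarith
    have e4 : f p.1 - φ₀ f = f (p.1 - z.1.1) + (f z.1.1 - φ₀ f) := by
      rw [map_sub]; ring
    rw [e4]
    refine (abs_add_le _ _).trans ?_
    linarith
  · linarith [norm_sub_le_norm_sub_add_norm_sub p.2 z.1.2 f₀]
  · linarith [norm_le_norm_add_norm_sub z.1.1 p.1, norm_sub_rev p.1 z.1.1]

/-! ### Translation from operators to graphs. -/

namespace SetOp

lemma inclusionInDoubleDual_sub_apply (p : X × StrongDual ℝ X)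
    (φ : StrongDual ℝ (StrongDual ℝ X)) (f : StrongDual ℝ X) :
    (NormedSpace.inclusionInDoubleDual ℝ X p.1 - φ) (p.2 - f)
      = p.2 p.1 - (f p.1 + φ p.2 - φ f) := by
  simp only [sub_apply, map_sub, NormedSpace.dual_def]
  ring

lemma IsTypeNI.conjugateDominates {A : X → Set (StrongDual ℝ X)} (hA : IsTypeNI A) :
    ConjugateDominates (gra A) := by
  intro φ f b h
  by_contra! hlt
  have h1 : ((φ f - b : ℝ) : EReal) ≤ relInf A φ f := by
    refine le_iInf₂ fun p hp => ?_
    rw [inclusionInDoubleDual_sub_apply, EReal.coe_le_coe_iff]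
    linarith [h p hp]
  have h2 := h1.trans (hA φ f)
  rw [← EReal.coe_zero, EReal.coe_le_coe_iff] at h2
  linarith

lemma pairing_le_of_relInf_nonneg {A : X → Set (StrongDual ℝ X)}
    {φ : StrongDual ℝ (StrongDual ℝ X)} {f : StrongDual ℝ X} (h : 0 ≤ relInf A φ f) :
    ∀ p ∈ gra A, f p.1 + φ p.2 - φ f ≤ p.2 p.1 := by
  intro p hp
  have h1 := h.trans (iInf₂_le p hp)
  rw [inclusionInDoubleDual_sub_apply, ← EReal.coe_zero, EReal.coe_le_coe_iff] at h1
  linarith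

/-- Adjoining `y` to the graph gives a monotone extension, which maximality forces to be trivial. -/
lemma IsMaximallyMonotone.mem_gra {A : X → Set (StrongDual ℝ X)} (hA : IsMaximallyMonotone A)
    (y : X × StrongDual ℝ X) (hy : ∀ q ∈ gra A, 0 ≤ (q.2 - y.2) (q.1 - y.1)) : y ∈ gra A := by
  let B : X → Set (StrongDual ℝ X) := fun x => {f | (x, f) ∈ gra A ∨ (x, f) = y}
  have hB : ∀ p, p ∈ gra B ↔ p ∈ gra A ∨ p = y := fun p => Iff.rfl
  rw [← hA.2 B ?_ fun p hp => (hB p).2 (Or.inl hp)]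
  · exact (hB y).2 (Or.inr rfl)
  · intro p hp q hq
    rcases (hB p).1 hp with hp' | rfl <;> rcases (hB q).1 hq with hq' | rfl
    · exact hA.1 p hp' q hq'
    · exact hy p hp'
    · rw [← neg_sub q.2, ← neg_sub q.1, map_neg, neg_apply, neg_neg]
      exact hy q hq'
    · simp

end SetOp

end

theorem mainTheorem2 {X : Type u} [NormedAddCommGroup X] [NormedSpace ℝ X] [CompleteSpace X]
    (A : X → Set (StrongDual ℝ X)) (hA : SetOp.IsMaximallyMonotone A) (hNI : SetOp.IsTypeNI A) :
    SetOp.IsTypeD A := by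
  classical
  intro φ f h
  have happrox : ∀ γ : Finset (StrongDual ℝ X) × ℕ, ∃ p ∈ SetOp.gra A,
      (∀ k ∈ γ.1, |k p.1 - φ k| ≤ 1 / ((γ.2 : ℝ) + 1) * (1 + ‖k‖)) ∧
      ‖p.2 - f‖ ≤ 1 / ((γ.2 : ℝ) + 1) ∧ ‖p.1‖ ≤ ‖φ‖ + 1 / ((γ.2 : ℝ) + 1) := fun γ =>
    hNI.conjugateDominates.exists_mem_approx hA.1 hA.mem_gra
      (SetOp.pairing_le_of_relInf_nonneg h) γ.1 Nat.one_div_pos_of_nat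
  choose p hp hpw hps hpb using happrox
  have hle : ∀ n : ℕ, 1 / ((n : ℝ) + 1) ≤ 1 := fun n => by
    rw [div_le_one (by positivity)]
    linarith [n.cast_nonneg (α := ℝ)]
  have hlim : Tendsto (fun γ : Finset (StrongDual ℝ X) × ℕ => 1 / ((γ.2 : ℝ) + 1)) atTop
      (𝓝 0) := by
    rw [← prod_atTop_atTop_eq]
    exact tendsto_one_div_add_atTop_nhds_zero_nat.comp tendsto_snd
  refine ⟨Finset (StrongDual ℝ X) × ℕ, inferInstance, inferInstance, inferInstance,
    fun γ => (p γ).1, fun γ => (p γ).2, hp, ⟨‖φ‖ + ‖f‖ + 1, fun γ => ⟨?_, ?_⟩⟩, ?_⟩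
  · linarith [hpb γ, hle γ.2, norm_nonneg f]
  · linarith [hps γ, hle γ.2, norm_nonneg φ, norm_le_norm_add_norm_sub f (p γ).2, norm_sub_rev f (p γ).2]
  · refine Tendsto.prodMk_nhds ?_ ?_
    · rw [tendsto_iff_forall_eval_tendsto_topDualPairing]
      intro k
      change Tendsto (fun γ => k (p γ).1) atTop (𝓝 (φ k))
      rw [tendsto_iff_dist_tendsto_zero]
      have hlim' := hlim.mul_const (1 + ‖k‖)
      rw [zero_mul] at hlim'
      refine squeeze_zero' (Eventually.of_forall fun _ => dist_nonneg) ?_ hlim'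
      filter_upwards [eventually_ge_atTop (({k}, 0) : Finset (StrongDual ℝ X) × ℕ)] with γ hγ
      exact hpw γ k (hγ.1 (Finset.mem_singleton_self k))
    · rw [tendsto_iff_norm_sub_tendsto_zero]
      exact squeeze_zero (fun _ => norm_nonneg _) hps hlim
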